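/- **Minimax lower bound for bandits with rewards missing completely at random (MCAR).** Setting. There are $n\ge 2$ arms, a horizon $T\ge 1$, and a nonempty finite set $\mathcal M$. A bandit instance $\nu$ assigns to each arm $a\in\{1,\dots,n\}$ a probability distribution of a tuple $(Y,O,M)\in\mathbb R\times\{0,1\}\times\mathcal M$ (reward, observation indicator, auxiliary variable), and $\mu_a=\mathbb E[Y\mid A=a]$. In each round $t=1,\dots,T$ the agent pulls an arm $a_t$, a tuple $(Y_t,O_t,M_t)$ is drawn from the distribution of $a_t$, independently of the past given $a_t$, and the agent sees $(Y^o_t,O_t,M_t)$, where $Y^o_t=Y_t$ if $O_t=1$ and $Y^o_t={?}$ otherwise. A policy $\pi$ chooses $a_t$, possibly at random, given the arms pulled and the feedback seen in the earlier rounds; it may depend on $n$, $T$, $\mathcal M$ and $\gamma$. The expected regret is $\mathbb E[R_T(\pi,\nu)]=\mathbb E\big[\sum_{t=1}^T(\max_a\mu_a-\mu_{a_t})\big]$. For $\gamma\in(0,1]$, the instance is *MCAR with observation probability $\gamma$* if $O$ is independent of $(A,Y,M)$ and $\mathbb P(O=1)=\gamma$, that is, under every arm $O$ is independent of $(Y,M)$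 and $\mathbb P(O=1\mid A=a)=\gamma$. Theorem. There is an absolute constant $c>0$ such that for all integers $n\ge2$ and $T\ge1$, every $\gamma\in(0,1]$, every nonempty finite set $\mathcal M$ and every policy $\pi$ there is an instance $\nu$ that is MCAR with observation probability $\gamma$, satisfies positivity ($\mathbb P(O=1\mid M=m,A=a)>0$ and $\mathbb P(M=m\mid A=a)>0$ for all $a,m$), has rewards with $Y-\mu_a$ sub-Gaussian with variance proxy $1$ under every arm $a$, and for which $$\mathbb E[R_T(\pi,\nu)]\;\ge\; c\,\sqrt{\frac{nT}{\gamma}}.$$ Moreover, if $\gamma T\ge n$, then $\nu$ can be chosen such that in addition $\mathbb E[Y\mid M=m,A=a]\in[0,1]$ for all $a,m$. -/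

import Mathlib

open MeasureTheory ProbabilityTheory
open scoped NNReal

noncomputable section

namespace MissingBandit

/-- What one pull draws: the reward `Y`, the indicator `O` that the reward is observed, and the
(always observed) auxiliary variable `M`. -/
abbrev Outcome (𝓜 : Type*) : Type _ := ℝ × Bool × 𝓜

/-- What the agent gets to see: the observed reward (a real number, or the symbol `?`, which is
`Sum.inr ()`), the indicator `O`, and the auxiliary variable `M`. -/
abbrev Feedback (𝓜 : Type*) : Type _ := (ℝ ⊕ Unit) × Bool × 𝓜

/-- The reward is shown if `O = 1` and replaced by `?` otherwise. -/
def observe {𝓜 : Type*} (ω : Outcome 𝓜) : Feedback 𝓜 :=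
  (if ω.2.1 = true then Sum.inl ω.1 else Sum.inr (), ω.2.1, ω.2.2)

/-- The history of `t` rounds: in each round the pulled arm and the feedback. -/
abbrev History (n : ℕ) (𝓜 : Type*) (t : ℕ) : Type _ := Fin t → Fin n × Feedback 𝓜

/-- An `n`-armed bandit instance: for each arm a probability distribution of `(Y, O, M)`. -/
structure Instance (n : ℕ) (𝓜 : Type*) [MeasurableSpace 𝓜] where
  law : Fin n → Measure (Outcome 𝓜)
  isProb : ∀ a, IsProbabilityMeasure (law a)

/-- A (possibly randomised) policy: for each `t`, the conditional distribution of the next arm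
given the history of the first `t` rounds. -/
structure Policy (n : ℕ) (𝓜 : Type*) [MeasurableSpace 𝓜] where
  act : (t : ℕ) → Kernel (History n 𝓜 t) (Fin n)
  isMarkov : ∀ t, IsMarkovKernel (act t)

attribute [instance] Instance.isProb Policy.isMarkov

variable {n : ℕ} {𝓜 : Type*} [MeasurableSpace 𝓜]

namespace Instance

/-- The expected reward of arm `a`. -/
def mean (ν : Instance n 𝓜) (a : Fin n) : ℝ := ∫ ω, ω.1 ∂(ν.law a)

/-- The largest expected reward of an arm. -/
def bestMean (ν : Instance n 𝓜) : ℝ := ⨆ a, ν.mean a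

/-- `𝔼[Y | M = m, A = a]`. -/
def condMean (ν : Instance n 𝓜) (a : Fin n) (m : 𝓜) : ℝ :=
  ∫ ω, ω.1 ∂(ProbabilityTheory.cond (ν.law a) {ω | ω.2.2 = m})

/-- Missing completely at random with observation probability `γ`: `O` is independent of
`(A, Y, M)` and `ℙ(O = 1) = γ`. As the instance is given arm by arm, this says that under every
arm `O` is independent of `(Y, M)` and has the same distribution, with `ℙ(O = 1) = γ`. -/
def IsMCAR (ν : Instance n 𝓜) (γ : ℝ) : Prop :=
  ∀ a, (ν.law a).real {ω | ω.2.1 = true} = γ ∧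
    IndepFun (fun ω : Outcome 𝓜 => ω.2.1) (fun ω : Outcome 𝓜 => (ω.1, ω.2.2)) (ν.law a)

/-- Positivity: `ℙ(O = 1 | M = m, A = a) > 0` and `ℙ(M = m | A = a) > 0` for all `a`, `m`. -/
def IsPositive (ν : Instance n 𝓜) : Prop :=
  ∀ a m, 0 < ProbabilityTheory.cond (ν.law a) {ω | ω.2.2 = m} {ω | ω.2.1 = true} ∧
    0 < ν.law a {ω | ω.2.2 = m}

/-- Under every arm the reward, centred at its expectation, is sub-Gaussian with variance
proxy `c`. -/
def IsSubgaussian (ν : Instance n 𝓜) (c : ℝ≥0) : Prop :=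
  ∀ a, HasSubgaussianMGF (fun ω : Outcome 𝓜 => ω.1 - ν.mean a) c (ν.law a)

/-- The distribution of the feedback, as a function of the pulled arm. -/
def feedback (ν : Instance n 𝓜) : Kernel (Fin n) (Feedback 𝓜) :=
  Kernel.ofFunOfCountable fun a => (ν.law a).map observe

/-- The cumulative regret of the pulls recorded in a history. -/
def regret (ν : Instance n 𝓜) {T : ℕ} (h : History n 𝓜 T) : ℝ :=
  ∑ t, (ν.bestMean - ν.mean (h t).1)

end Instance

/-- One round after a history of `t` rounds: the policy draws an arm, then the instance draws the
feedback of this arm. -/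
def roundKernel (π : Policy n 𝓜) (ν : Instance n 𝓜) (t : ℕ) :
    Kernel (History n 𝓜 t) (Fin n × Feedback 𝓜) :=
  (π.act t).compProd (Kernel.prodMkLeft (History n 𝓜 t) ν.feedback)

/-- Appending a round to a history. -/
def appendRound {t : ℕ} (p : History n 𝓜 t × (Fin n × Feedback 𝓜)) : History n 𝓜 (t + 1) :=
  Fin.snoc (α := fun _ => Fin n × Feedback 𝓜) p.1 p.2

/-- The distribution of the history of the first `t` rounds of the interaction of policy `π` with
instance `ν`. -/
def historyLaw (π : Policy n 𝓜) (ν : Instance n 𝓜) : (t : ℕ) → Measure (History n 𝓜 t)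
  | 0 => Measure.dirac Fin.elim0
  | t + 1 => ((historyLaw π ν t).compProd (roundKernel π ν t)).map appendRound

/-- The expected cumulative regret over `T` rounds. -/
def expectedRegret (π : Policy n 𝓜) (ν : Instance n 𝓜) (T : ℕ) : ℝ :=
  ∫ h, ν.regret h ∂(historyLaw π ν T)

/-! All the distributions above are probability measures. -/

theorem measurable_observe : Measurable (observe : Outcome 𝓜 → Feedback 𝓜) := by
  unfold observe
  refine Measurable.prodMk (Measurable.ite ?_ ?_ measurable_const) measurable_snd
  · exact measurable_snd.fst (measurableSet_singleton true)
  · exact measurable_inl.comp measurable_fst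

theorem measurable_appendRound {t : ℕ} :
    Measurable (appendRound : History n 𝓜 t × (Fin n × Feedback 𝓜) → History n 𝓜 (t + 1)) := by
  refine measurable_pi_lambda _ fun i => ?_
  refine Fin.lastCases ?_ (fun j => ?_) i
  · simpa [appendRound] using measurable_snd
  · simp only [appendRound, Fin.snoc_castSucc]
    exact (measurable_pi_apply j).comp measurable_fst

instance isMarkovKernel_feedback (ν : Instance n 𝓜) : IsMarkovKernel ν.feedback :=
  ⟨fun a => Measure.isProbabilityMeasure_map (μ := ν.law a) measurable_observe.aemeasurable⟩

instance isMarkovKernel_roundKernel (π : Policy n 𝓜) (ν : Instance n 𝓜) (t : ℕ) :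
    IsMarkovKernel (roundKernel π ν t) := by
  unfold roundKernel
  infer_instance

instance isProbabilityMeasure_historyLaw (π : Policy n 𝓜) (ν : Instance n 𝓜) (t : ℕ) :
    IsProbabilityMeasure (historyLaw π ν t) := by
  induction t with
  | zero => unfold historyLaw; infer_instance
  | succ t ih =>
    unfold historyLaw
    exact Measure.isProbabilityMeasure_map measurable_appendRound.aemeasurable

end MissingBandit

end

/-!
The lower bound averages over `n` alternatives to a base instance. In the base instance every arm
has a standard Gaussian reward, the observation indicator `O` is an independent Bernoulli variable
of parameter `γ`, and `M` is uniform and independent of both. The alternative number `a` raises the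
mean of arm `a` to `Δ`. All of these are missing completely at random and satisfy positivity.

A pull of arm `a` separates the two instances only if its reward is observed, so it contributes a
Kullback–Leibler divergence of `γ Δ² / 2` instead of `Δ² / 2`. The policy is common to both
instances, so the history law of the alternative has density `exp Z` with respect to the base law,
with `Z` the sum of the log-likelihood ratios of the rounds (`historyLaw_eq_withDensity`). Adding
`γ Δ² / 2` for every pull of `a` turns `Z` into a sum of centred terms
(`integral_sum_history_eq_zero`), so the total divergence is `γ Δ² / 2` times the expected number of
pulls of `a` in the base instance.

To compare pull counts under the two laws, Pinsker's inequality is used in the form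
`TV(P, Q) ≤ r + KL / (2 r)` with `r > 0` free (`integral_withDensity_exp_le`). It follows by
integrating a pointwise inequality (`one_sub_exp_le`), and being linear in the divergence it can be
summed over `a`, where the pull counts of the base instance add up to `T`. With
`Δ = √(n / (γ T)) / 4` and `r = 1 / 8`, the average over `a` of the expected number of pulls of `a`
under alternative `a` is at most `T / n + T / 4 ≤ 3 T / 4`, so some alternative has regret at least
`Δ T / 4 = √(n T / γ) / 16` (`exists_expectedRegret_ge`).

Gaussian rewards allow gaps `Δ` of any size, as needed when `γ T < n`; when `γ T ≥ n`, the gap is at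
most `1 / 4` and all conditional means, which equal the arm means, lie in `[0, 1]`.
-/

open MeasureTheory ProbabilityTheory

noncomputable section

namespace MissingBandit

/-! ### Gaussian instances with rewards missing completely at random -/

section GaussianLaw

variable {𝓜 : Type*} [MeasurableSpace 𝓜]

theorem gaussianReal_eq_withDensity (x : ℝ) :
    gaussianReal x 1 =
      (gaussianReal 0 1).withDensity fun y => ENNReal.ofReal (Real.exp (x * y - x ^ 2 / 2)) := by
  rw [gaussianReal_of_var_ne_zero _ one_ne_zero, gaussianReal_of_var_ne_zero _ one_ne_zero,
    ← withDensity_mul _ (measurable_gaussianPDF _ _) (by fun_prop)]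
  congr 1
  ext y
  simp only [gaussianPDF, gaussianPDFReal, Pi.mul_apply]
  rw [← ENNReal.ofReal_mul (by positivity), mul_assoc _ (Real.exp _) (Real.exp _), ← Real.exp_add]
  congr 3
  simp only [NNReal.coe_one]
  ring

/-- The independent triple `(O, Y, M)` with `O` Bernoulli of parameter `p`, `Y` standard Gaussian
shifted by `x`, and `M` uniform. -/
def gaussianSource (𝓜 : Type*) [MeasurableSpace 𝓜] (p : unitInterval) (x : ℝ) :
    Measure (Bool × ℝ × 𝓜) :=
  (bernoulliMeasure true false p).prod ((gaussianReal x 1).prod (uniformOn Set.univ))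

/-- The law of `(Y, O, M)` with independent coordinates: `Y` Gaussian with mean `x` and variance
`1`, `O` Bernoulli of parameter `p`, `M` uniform. It is the image of `gaussianSource`, which lists
`O` first, so that independence of `O` from `(Y, M)` is that of the two factors of a product. -/
def gaussianLaw (𝓜 : Type*) [MeasurableSpace 𝓜] (p : unitInterval) (x : ℝ) :
    Measure (Outcome 𝓜) :=
  (gaussianSource 𝓜 p x).map fun q => (q.2.1, q.1, q.2.2)

/-- The log-likelihood ratio of a feedback between reward mean `x` and reward mean `0`. An
unobserved reward carries no information. -/
def logLikelihoodRatio {𝓜 : Type*} (x : ℝ) (F : Feedback 𝓜) : ℝ :=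
  Sum.elim (fun y => x * y - x ^ 2 / 2) (fun _ => 0) F.1

theorem measurable_logLikelihoodRatio (x : ℝ) :
    Measurable (logLikelihoodRatio x : Feedback 𝓜 → ℝ) :=
  (Measurable.sumElim (by fun_prop) measurable_const).comp measurable_fst

theorem logLikelihoodRatio_observe {𝓜 : Type*} (x : ℝ) (ω : Outcome 𝓜) :
    logLikelihoodRatio x (observe ω) = (if ω.2.1 = true then 1 else 0) * (x * ω.1 - x ^ 2 / 2) := by
  by_cases h : ω.2.1 = true <;> simp [logLikelihoodRatio, observe, h]

theorem measurable_sourceReorder :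
    Measurable fun q : Bool × ℝ × 𝓜 => ((q.2.1, q.1, q.2.2) : Outcome 𝓜) := by
  fun_prop

theorem measurableSet_observed : MeasurableSet {ω : Outcome 𝓜 | ω.2.1 = true} :=
  (measurable_fst.comp measurable_snd) (measurableSet_singleton true)

theorem measurableSet_auxiliary [MeasurableSingletonClass 𝓜] (m : 𝓜) :
    MeasurableSet {ω : Outcome 𝓜 | ω.2.2 = m} :=
  (measurable_snd.comp measurable_snd) (measurableSet_singleton m)

theorem uniformOn_univ_singleton_ne_zero [Finite 𝓜] [MeasurableSingletonClass 𝓜] (m : 𝓜) :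
    uniformOn (Set.univ : Set 𝓜) {m} ≠ 0 := by
  rw [Ne, uniformOn_eq_zero_iff Set.finite_univ]
  simp

theorem gaussianLaw_auxiliary [Finite 𝓜] [MeasurableSingletonClass 𝓜]
    (p : unitInterval) (x : ℝ) (m : 𝓜) :
    gaussianLaw 𝓜 p x {ω | ω.2.2 = m} = uniformOn Set.univ {m} := by
  have h : (fun q : Bool × ℝ × 𝓜 => ((q.2.1, q.1, q.2.2) : Outcome 𝓜)) ⁻¹' {ω | ω.2.2 = m} =
      Set.univ ×ˢ (Set.univ ×ˢ {m}) := by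
    ext q; simp
  rw [gaussianLaw, Measure.map_apply measurable_sourceReorder (measurableSet_auxiliary m), h,
    gaussianSource, Measure.prod_prod, Measure.prod_prod, measure_univ, measure_univ, one_mul,
    one_mul]

theorem gaussianLaw_auxiliary_inter_observed [Finite 𝓜] [MeasurableSingletonClass 𝓜]
    (p : unitInterval) (x : ℝ) (m : 𝓜) :
    gaussianLaw 𝓜 p x ({ω | ω.2.2 = m} ∩ {ω | ω.2.1 = true}) =
      bernoulliMeasure true false p {true} * uniformOn Set.univ {m} := by
  have h : (fun q : Bool × ℝ × 𝓜 => ((q.2.1, q.1, q.2.2) : Outcome 𝓜)) ⁻¹'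
      ({ω | ω.2.2 = m} ∩ {ω | ω.2.1 = true}) = {true} ×ˢ (Set.univ ×ˢ {m}) := by
    ext q; simp [and_comm]
  rw [gaussianLaw, Measure.map_apply measurable_sourceReorder
    ((measurableSet_auxiliary m).inter measurableSet_observed), h,
    gaussianSource, Measure.prod_prod, Measure.prod_prod, measure_univ, one_mul]

theorem lintegral_gaussianLaw [Finite 𝓜] (p : unitInterval) (x : ℝ) {f : Outcome 𝓜 → ENNReal}
    (hf : Measurable f) :
    ∫⁻ ω, f ω ∂(gaussianLaw 𝓜 p x) =
      ∫⁻ o, ∫⁻ m, ∫⁻ y, f (y, o, m) ∂(gaussianReal x 1) ∂(uniformOn Set.univ)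
        ∂(bernoulliMeasure true false p) := by
  rw [gaussianLaw, lintegral_map hf measurable_sourceReorder, gaussianSource]
  refine (lintegral_prod _ (hf.comp measurable_sourceReorder).aemeasurable).trans
    (lintegral_congr fun o => ?_)
  exact lintegral_prod_symm' _ (hf.comp (by fun_prop))

theorem integral_cond_gaussianLaw [Finite 𝓜] [MeasurableSingletonClass 𝓜]
    (p : unitInterval) (x : ℝ) (m : 𝓜) :
    ∫ ω, ω.1 ∂(ProbabilityTheory.cond (gaussianLaw 𝓜 p x) {ω | ω.2.2 = m}) = x := by
  have h : (fun q : Bool × ℝ × 𝓜 => ((q.2.1, q.1, q.2.2) : Outcome 𝓜)) ⁻¹' {ω | ω.2.2 = m} =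
      Set.univ ×ˢ (Set.univ ×ˢ {m}) := by
    ext q; simp
  rw [ProbabilityTheory.cond, integral_smul_measure, gaussianLaw_auxiliary, gaussianLaw,
    Measure.restrict_map measurable_sourceReorder (measurableSet_auxiliary m), h,
    integral_map measurable_sourceReorder.aemeasurable (by fun_prop), gaussianSource,
    ← Measure.prod_restrict, ← Measure.prod_restrict, Measure.restrict_univ, Measure.restrict_univ,
    integral_fun_snd (fun z : ℝ × 𝓜 => z.1), integral_fun_fst (fun y : ℝ => y),
    integral_id_gaussianReal,
    probReal_univ, one_smul, measureReal_restrict_apply_univ, ENNReal.toReal_inv, smul_smul]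
  have h0 : (uniformOn (Set.univ : Set 𝓜)).real {m} ≠ 0 := by
    rw [Ne, measureReal_eq_zero_iff]
    exact uniformOn_univ_singleton_ne_zero m
  change (((uniformOn (Set.univ : Set 𝓜)).real {m})⁻¹ *
    (uniformOn (Set.univ : Set 𝓜)).real {m}) • x = x
  rw [inv_mul_cancel₀ h0, one_smul]

/-- Shifting the reward mean from `0` to `x` reweights the feedback by its likelihood ratio: given
`O = 1` this is the Gaussian change of mean, and given `O = 0` the feedback does not depend on the
reward. -/
theorem map_observe_gaussianLaw [Finite 𝓜] (p : unitInterval) (x : ℝ) :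
    (gaussianLaw 𝓜 p x).map observe =
      ((gaussianLaw 𝓜 p 0).map observe).withDensity
        fun F => ENNReal.ofReal (Real.exp (logLikelihoodRatio x F)) := by
  have hd : Measurable fun F : Feedback 𝓜 => ENNReal.ofReal (Real.exp (logLikelihoodRatio x F)) :=
    (Real.measurable_exp.comp (measurable_logLikelihoodRatio x)).ennreal_ofReal
  refine Measure.ext_of_lintegral _ fun f hf => ?_
  rw [lintegral_withDensity_eq_lintegral_mul _ hd hf, lintegral_map hf measurable_observe,
    lintegral_map (hd.mul hf) measurable_observe]
  refine (lintegral_gaussianLaw p x (hf.comp measurable_observe)).trans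
    (Eq.trans ?_ (lintegral_gaussianLaw p 0 ((hd.mul hf).comp measurable_observe)).symm)
  refine lintegral_congr fun o => lintegral_congr fun m => ?_
  cases o with
  | false => simp [observe, logLikelihoodRatio]
  | true =>
    have hf' : Measurable fun y : ℝ => f (observe (y, true, m)) :=
      hf.comp (measurable_observe.comp (by fun_prop))
    rw [gaussianReal_eq_withDensity x, lintegral_withDensity_eq_lintegral_mul _ (by fun_prop)
      (by exact hf')]
    simp [observe, logLikelihoodRatio]

variable [Finite 𝓜] [Nonempty 𝓜] [MeasurableSingletonClass 𝓜]

instance isProbabilityMeasure_uniformOn_univ :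
    IsProbabilityMeasure (uniformOn (Set.univ : Set 𝓜)) :=
  isProbabilityMeasure_uniformOn Set.finite_univ Set.univ_nonempty

instance isProbabilityMeasure_gaussianSource (p : unitInterval) (x : ℝ) :
    IsProbabilityMeasure (gaussianSource 𝓜 p x) := by
  unfold gaussianSource; infer_instance

instance isProbabilityMeasure_gaussianLaw (p : unitInterval) (x : ℝ) :
    IsProbabilityMeasure (gaussianLaw 𝓜 p x) :=
  Measure.isProbabilityMeasure_map measurable_sourceReorder.aemeasurable

theorem map_fst_gaussianLaw (p : unitInterval) (x : ℝ) :
    (gaussianLaw 𝓜 p x).map Prod.fst = gaussianReal x 1 := by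
  rw [gaussianLaw, Measure.map_map measurable_fst measurable_sourceReorder]
  change (gaussianSource 𝓜 p x).map (Prod.fst ∘ Prod.snd) = _
  rw [← Measure.map_map measurable_fst measurable_snd, gaussianSource, Measure.map_snd_prod,
    measure_univ, one_smul, Measure.map_fst_prod, measure_univ, one_smul]

theorem integral_fst_gaussianLaw (p : unitInterval) (x : ℝ) :
    ∫ ω, ω.1 ∂(gaussianLaw 𝓜 p x) = x := by
  have h := integral_map (μ := gaussianLaw 𝓜 p x) (φ := Prod.fst) measurable_fst.aemeasurable
    (f := fun y : ℝ => y) (by fun_prop)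
  rw [← h, map_fst_gaussianLaw, integral_id_gaussianReal]

theorem hasSubgaussianMGF_gaussianLaw (p : unitInterval) (x : ℝ) :
    HasSubgaussianMGF (fun ω : Outcome 𝓜 => ω.1 - x) 1 (gaussianLaw 𝓜 p x) := by
  refine HasSubgaussianMGF.of_map (Y := fun ω : Outcome 𝓜 => ω.1 - x) (X := id)
    (by fun_prop) ?_
  have h : (gaussianLaw 𝓜 p x).map (fun ω : Outcome 𝓜 => ω.1 - x) = gaussianReal 0 1 := by
    change (gaussianLaw 𝓜 p x).map ((fun y : ℝ => y - x) ∘ Prod.fst) = _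
    rw [← Measure.map_map (by fun_prop) measurable_fst, map_fst_gaussianLaw,
      gaussianReal_map_sub_const, sub_self]
  rw [h]
  refine ⟨fun t => integrable_exp_mul_gaussianReal t, fun t => ?_⟩
  rw [mgf_id_gaussianReal]
  simp

theorem indepFun_gaussianLaw (p : unitInterval) (x : ℝ) :
    IndepFun (fun ω : Outcome 𝓜 => ω.2.1) (fun ω : Outcome 𝓜 => (ω.1, ω.2.2))
      (gaussianLaw 𝓜 p x) := by
  rw [indepFun_iff_measure_inter_preimage_eq_mul]
  intro s t hs ht
  have hs' : MeasurableSet ((fun ω : Outcome 𝓜 => ω.2.1) ⁻¹' s) :=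
    (measurable_fst.comp measurable_snd) hs
  have ht' : MeasurableSet ((fun ω : Outcome 𝓜 => (ω.1, ω.2.2)) ⁻¹' t) :=
    (show Measurable (fun ω : Outcome 𝓜 => (ω.1, ω.2.2)) by fun_prop) ht
  rw [gaussianLaw, Measure.map_apply measurable_sourceReorder (hs'.inter ht'),
    Measure.map_apply measurable_sourceReorder hs', Measure.map_apply measurable_sourceReorder ht']
  exact indepFun_iff_measure_inter_preimage_eq_mul.1
    (indepFun_prod (μ := bernoulliMeasure true false p)
      (ν := (gaussianReal x 1).prod (uniformOn (Set.univ : Set 𝓜))) measurable_id measurable_id)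
    s t hs ht

theorem gaussianLaw_observed (p : unitInterval) (x : ℝ) :
    (gaussianLaw 𝓜 p x).real {ω | ω.2.1 = true} = p := by
  have h : (fun q : Bool × ℝ × 𝓜 => ((q.2.1, q.1, q.2.2) : Outcome 𝓜)) ⁻¹' {ω | ω.2.1 = true} =
      {true} ×ˢ Set.univ := by
    ext q; simp
  rw [gaussianLaw, map_measureReal_apply measurable_sourceReorder measurableSet_observed, h,
    gaussianSource, measureReal_prod_prod, probReal_univ, mul_one]
  simp

theorem integrable_logLikelihoodRatio (p : unitInterval) (x : ℝ) :
    Integrable (logLikelihoodRatio x) ((gaussianLaw 𝓜 p 0).map observe) ∧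
      ∫ F, logLikelihoodRatio x F ∂((gaussianLaw 𝓜 p 0).map observe) = -(p * x ^ 2 / 2) := by
  have hm : AEStronglyMeasurable (logLikelihoodRatio x) ((gaussianLaw 𝓜 p 0).map observe) :=
    (measurable_logLikelihoodRatio x).aestronglyMeasurable
  have hmo : Measurable fun ω : Outcome 𝓜 => logLikelihoodRatio x (observe ω) :=
    (measurable_logLikelihoodRatio x).comp measurable_observe
  have hid : Integrable (fun y : ℝ => y) (gaussianReal 0 1) :=
    (memLp_id_gaussianReal 1).integrable (by simp)
  have hy : Integrable (fun y : ℝ => x * y - x ^ 2 / 2) (gaussianReal 0 1) :=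
    (hid.const_mul x).sub (integrable_const _)
  have hz : Integrable (fun z : ℝ × 𝓜 => x * z.1 - x ^ 2 / 2)
      ((gaussianReal 0 1).prod (uniformOn Set.univ)) := hy.comp_fst _
  have ho : Integrable (fun o : Bool => if o = true then (1 : ℝ) else 0)
      (bernoulliMeasure true false p) := Integrable.of_finite
  constructor
  · rw [integrable_map_measure hm measurable_observe.aemeasurable]
    change Integrable (fun ω : Outcome 𝓜 => logLikelihoodRatio x (observe ω)) _
    rw [gaussianLaw, integrable_map_measure hmo.aestronglyMeasurable
      measurable_sourceReorder.aemeasurable]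
    refine (ho.mul_prod hz).congr (Filter.Eventually.of_forall fun q => ?_)
    simp only [Function.comp_apply, logLikelihoodRatio_observe]
  · rw [integral_map measurable_observe.aemeasurable hm, gaussianLaw,
      integral_map measurable_sourceReorder.aemeasurable hmo.aestronglyMeasurable]
    simp only [logLikelihoodRatio_observe]
    rw [gaussianSource, integral_prod_mul (fun o : Bool => if o = true then (1 : ℝ) else 0)
      (fun z : ℝ × 𝓜 => x * z.1 - x ^ 2 / 2), integral_fun_fst (fun y : ℝ => x * y - x ^ 2 / 2),
      integral_sub (hid.const_mul x) (integrable_const _), integral_const_mul,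
      integral_id_gaussianReal, integral_bernoulliMeasure]
    simp
    ring

variable {n : ℕ}

/-- The instance whose arm `a` has unit-variance Gaussian rewards with mean `θ a`, independent of
the observation indicator and of the uniform auxiliary variable. -/
def gaussianInstance (𝓜 : Type*) [MeasurableSpace 𝓜] [Finite 𝓜] [Nonempty 𝓜]
    [MeasurableSingletonClass 𝓜] (p : unitInterval) (θ : Fin n → ℝ) : Instance n 𝓜 where
  law a := gaussianLaw 𝓜 p (θ a)
  isProb _ := inferInstance

theorem mean_gaussianInstance (p : unitInterval) (θ : Fin n → ℝ) (a : Fin n) :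
    (gaussianInstance 𝓜 p θ).mean a = θ a :=
  integral_fst_gaussianLaw p (θ a)

theorem condMean_gaussianInstance (p : unitInterval) (θ : Fin n → ℝ) (a : Fin n) (m : 𝓜) :
    (gaussianInstance 𝓜 p θ).condMean a m = θ a :=
  integral_cond_gaussianLaw p (θ a) m

theorem isMCAR_gaussianInstance (p : unitInterval) (θ : Fin n → ℝ) :
    (gaussianInstance 𝓜 p θ).IsMCAR p :=
  fun a => ⟨gaussianLaw_observed p (θ a), indepFun_gaussianLaw p (θ a)⟩

theorem isPositive_gaussianInstance {p : unitInterval} (hp : 0 < (p : ℝ)) (θ : Fin n → ℝ) :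
    (gaussianInstance 𝓜 p θ).IsPositive := by
  intro a m
  change 0 < ProbabilityTheory.cond (gaussianLaw 𝓜 p (θ a)) _ _ ∧ 0 < gaussianLaw 𝓜 p (θ a) _
  refine ⟨cond_pos_of_inter_ne_zero (measurableSet_auxiliary m) ?_, ?_⟩
  · rw [gaussianLaw_auxiliary_inter_observed]
    refine mul_ne_zero ?_ (uniformOn_univ_singleton_ne_zero m)
    intro h
    have h' : (bernoulliMeasure true false p).real {true} = 0 := by simp [measureReal_def, h]
    simp at h'
    simp [h'] at hp
  · rw [gaussianLaw_auxiliary]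
    exact pos_iff_ne_zero.2 (uniformOn_univ_singleton_ne_zero m)

theorem isSubgaussian_gaussianInstance (p : unitInterval) (θ : Fin n → ℝ) :
    (gaussianInstance 𝓜 p θ).IsSubgaussian 1 := by
  intro a
  rw [mean_gaussianInstance]
  exact hasSubgaussianMGF_gaussianLaw p (θ a)

end GaussianLaw

/-! ### Laws of the history -/

section History

theorem sum_appendRound {n : ℕ} {𝓜 : Type*} {t : ℕ} {β : Type*} [AddCommMonoid β]
    (g : Fin n × Feedback 𝓜 → β) (q : History n 𝓜 t × (Fin n × Feedback 𝓜)) :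
    ∑ i, g (appendRound q i) = ∑ i, g (q.1 i) + g q.2 := by
  simp [Fin.sum_univ_castSucc, appendRound]

variable {n : ℕ} {𝓜 : Type*} [MeasurableSpace 𝓜]

theorem lintegral_historyLaw_succ (π : Policy n 𝓜) (ν : Instance n 𝓜) (t : ℕ)
    {f : History n 𝓜 (t + 1) → ENNReal} (hf : Measurable f) :
    ∫⁻ h, f h ∂(historyLaw π ν (t + 1)) =
      ∫⁻ h, ∫⁻ x, f (appendRound (h, x)) ∂(roundKernel π ν t h) ∂(historyLaw π ν t) := by
  rw [historyLaw, lintegral_map hf measurable_appendRound]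
  exact Measure.lintegral_compProd (hf.comp measurable_appendRound)

theorem lintegral_roundKernel (π : Policy n 𝓜) (ν : Instance n 𝓜) (t : ℕ) (h : History n 𝓜 t)
    {f : Fin n × Feedback 𝓜 → ENNReal} (hf : Measurable f) :
    ∫⁻ x, f x ∂(roundKernel π ν t h) = ∫⁻ a, ∫⁻ F, f (a, F) ∂(ν.feedback a) ∂(π.act t h) := by
  rw [roundKernel, Kernel.lintegral_compProd _ _ _ hf]
  simp

/-- The policy does not depend on the instance, so its contribution to the density of a round
cancels. -/
theorem roundKernel_eq_withDensity (π : Policy n 𝓜) {ν ν' : Instance n 𝓜}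
    {d : Fin n × Feedback 𝓜 → ENNReal} (hd : Measurable d)
    (hν : ∀ a, ν'.feedback a = (ν.feedback a).withDensity fun F => d (a, F)) (t : ℕ)
    (h : History n 𝓜 t) : roundKernel π ν' t h = (roundKernel π ν t h).withDensity d := by
  refine Measure.ext_of_lintegral _ fun f hf => ?_
  rw [lintegral_withDensity_eq_lintegral_mul _ hd hf, lintegral_roundKernel _ _ _ _ hf,
    lintegral_roundKernel _ _ _ _ (hd.mul hf)]
  refine lintegral_congr fun a => ?_
  rw [hν, lintegral_withDensity_eq_lintegral_mul _ (by fun_prop) (by fun_prop)]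
  rfl

/-- If the feedback laws of `ν'` have densities `exp g` with respect to those of `ν`, then the
history law of `ν'` has as density the product of the densities of the rounds. -/
theorem historyLaw_eq_withDensity (π : Policy n 𝓜) {ν ν' : Instance n 𝓜}
    {g : Fin n × Feedback 𝓜 → ℝ} (hg : Measurable g)
    (hν : ∀ a, ν'.feedback a =
      (ν.feedback a).withDensity fun F => ENNReal.ofReal (Real.exp (g (a, F)))) (t : ℕ) :
    historyLaw π ν' t =
      (historyLaw π ν t).withDensity fun h => ENNReal.ofReal (Real.exp (∑ i, g (h i))) := by
  induction t with
  | zero => simp [historyLaw]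
  | succ t ih =>
    have hd (s : ℕ) : Measurable fun h : History n 𝓜 s =>
        ENNReal.ofReal (Real.exp (∑ i, g (h i))) := by fun_prop
    have hg1 : Measurable fun x => ENNReal.ofReal (Real.exp (g x)) := by fun_prop
    refine Measure.ext_of_lintegral _ fun f hf => ?_
    have hfa := hf.comp (measurable_appendRound (n := n) (𝓜 := 𝓜) (t := t))
    have hfx (h : History n 𝓜 t) : Measurable fun x => f (appendRound (h, x)) :=
      hfa.comp measurable_prodMk_left
    rw [lintegral_withDensity_eq_lintegral_mul _ (hd _) hf, lintegral_historyLaw_succ _ _ _ hf,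
      lintegral_historyLaw_succ _ _ _ ((hd _).mul hf), ih,
      lintegral_withDensity_eq_lintegral_mul _ (hd t)
        (by exact hfa.lintegral_kernel_prod_right')]
    refine lintegral_congr fun h => ?_
    rw [Pi.mul_apply, roundKernel_eq_withDensity π hg1 hν,
      lintegral_withDensity_eq_lintegral_mul _ hg1 (by exact hfx h),
      ← lintegral_const_mul _ (by exact hg1.mul (hfx h))]
    refine lintegral_congr fun x => ?_
    simp only [Pi.mul_apply]
    rw [sum_appendRound, Real.exp_add, ENNReal.ofReal_mul (Real.exp_nonneg _), mul_assoc]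

/-- A sum over the rounds of a function of the round that is centred under every arm is centred,
whatever the policy. -/
theorem integral_sum_history_eq_zero (π : Policy n 𝓜) (ν : Instance n 𝓜)
    {g : Fin n × Feedback 𝓜 → ℝ} (hg : Measurable g)
    (hint : ∀ a, Integrable (fun F => g (a, F)) (ν.feedback a))
    (hzero : ∀ a, ∫ F, g (a, F) ∂(ν.feedback a) = 0) (t : ℕ) :
    Integrable (fun h : History n 𝓜 t => ∑ i, g (h i)) (historyLaw π ν t) ∧
      ∫ h, ∑ i, g (h i) ∂(historyLaw π ν t) = 0 := by
  induction t with
  | zero => simp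
  | succ t ih =>
    obtain ⟨ihi, ih0⟩ := ih
    have hround (h : History n 𝓜 t) : Integrable g (roundKernel π ν t h) := by
      rw [roundKernel, ProbabilityTheory.integrable_compProd_iff hg.aestronglyMeasurable]
      exact ⟨Filter.Eventually.of_forall fun a => by simpa using hint a, Integrable.of_finite⟩
    have hround0 (h : History n 𝓜 t) : ∫ x, g x ∂(roundKernel π ν t h) = 0 := by
      have := hround h
      rw [roundKernel] at this ⊢
      rw [ProbabilityTheory.integral_compProd this]
      simp [hzero]
    have hfst : Integrable (fun q : History n 𝓜 t × (Fin n × Feedback 𝓜) => ∑ i, g (q.1 i))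
        ((historyLaw π ν t).compProd (roundKernel π ν t)) := by
      have hmp : MeasurePreserving Prod.fst ((historyLaw π ν t).compProd (roundKernel π ν t))
          (historyLaw π ν t) := ⟨measurable_fst, Measure.fst_compProd _ _⟩
      exact (hmp.integrable_comp ihi.aestronglyMeasurable).2 ihi
    have hsnd : Integrable (fun q : History n 𝓜 t × (Fin n × Feedback 𝓜) => g q.2)
        ((historyLaw π ν t).compProd (roundKernel π ν t)) := by
      rw [Measure.integrable_compProd_iff (by exact (hg.comp measurable_snd).aestronglyMeasurable)]
      refine ⟨Filter.Eventually.of_forall hround, ?_⟩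
      -- The conditional first absolute moment is an average over the finitely many arms.
      refine Integrable.of_bound
        (hg.norm.stronglyMeasurable.integral_kernel (κ := roundKernel π ν t)).aestronglyMeasurable
        (∑ a, ∫ F, ‖g (a, F)‖ ∂(ν.feedback a)) (Filter.Eventually.of_forall fun h => ?_)
      have hn := (hround h).norm
      rw [Real.norm_of_nonneg (integral_nonneg fun _ => norm_nonneg _)]
      rw [roundKernel] at hn ⊢
      rw [ProbabilityTheory.integral_compProd hn]
      simp only [Kernel.prodMkLeft_apply]
      calc _ ≤ ∫ _, ∑ a, ∫ F, ‖g (a, F)‖ ∂(ν.feedback a) ∂(π.act t h) := by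
            refine integral_mono Integrable.of_finite (integrable_const _) fun a => ?_
            exact Finset.single_le_sum (f := fun a => ∫ F, ‖g (a, F)‖ ∂(ν.feedback a))
              (fun b _ => integral_nonneg fun _ => norm_nonneg _) (Finset.mem_univ a)
        _ = _ := by simp
    have hS : AEStronglyMeasurable (fun h : History n 𝓜 (t + 1) => ∑ i, g (h i))
        (((historyLaw π ν t).compProd (roundKernel π ν t)).map appendRound) :=
      Measurable.aestronglyMeasurable (by fun_prop)
    rw [historyLaw]
    constructor
    · rw [integrable_map_measure hS measurable_appendRound.aemeasurable]
      exact (hfst.add hsnd).congr (Filter.Eventually.of_forall fun q => (sum_appendRound g q).symm)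
    · rw [integral_map measurable_appendRound.aemeasurable hS]
      simp only [sum_appendRound]
      rw [integral_add hfst hsnd, Measure.integral_compProd hfst, Measure.integral_compProd hsnd]
      simp [hround0, ih0]

end History

/-! ### Transport of bounded functions along a change of measure -/

/-- A quadratic lower bound on `exp z - 1 - z` for `z ≤ 0`, linearised by the inequality between
arithmetic and geometric means; for `z ≥ 0` the left side is not positive. -/
theorem one_sub_exp_le (z : ℝ) {r : ℝ} (hr : 0 < r) :
    1 - Real.exp z ≤ r + (Real.exp z - 1 - z) / (2 * r) := by
  have hE := Real.add_one_le_exp z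
  rcases le_total 0 z with hz | hz
  · have h1 := Real.one_le_exp hz
    have : 0 ≤ (Real.exp z - 1 - z) / (2 * r) := div_nonneg (by linarith) (by positivity)
    linarith
  · set u := 1 - Real.exp z with hu
    have hu0 : 0 ≤ u := by have := Real.exp_le_one_iff.2 hz; linarith
    have hu1 : u < 1 := by have := Real.exp_pos z; linarith
    have hs := Real.hasSum_pow_div_log_of_abs_lt_one (x := u) (by rw [abs_of_nonneg hu0]; exact hu1)
    have h2 := sum_le_hasSum (Finset.range 2) (fun i _ => by positivity) hs
    have hlog : Real.log (1 - u) = z := by rw [hu, sub_sub_cancel, Real.log_exp]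
    rw [hlog] at h2
    norm_num [Finset.sum_range_succ] at h2
    have h3 : u ^ 2 / 2 ≤ Real.exp z - 1 - z := by linarith
    have h4 : u ^ 2 / 2 / (2 * r) ≤ (Real.exp z - 1 - z) / (2 * r) := by gcongr
    have h5 : u ≤ r + u ^ 2 / 2 / (2 * r) := by
      rw [div_div, ← sub_le_iff_le_add', le_div_iff₀ (by positivity)]
      nlinarith [sq_nonneg (u - 2 * r)]
    linarith

/-- A form of Pinsker's inequality that is linear in the Kullback–Leibler divergence `∫ -Z ∂P` of
`P` from `Q = exp Z • P`. -/
theorem integral_withDensity_exp_le {Ω : Type*} [MeasurableSpace Ω] {P Q : Measure Ω}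
    [IsProbabilityMeasure P] [IsProbabilityMeasure Q] {Z : Ω → ℝ} (hZ : Measurable Z)
    (hZi : Integrable Z P)
    (hQ : Q = P.withDensity fun ω => ENNReal.ofReal (Real.exp (Z ω))) {f : Ω → ℝ}
    (hf : Measurable f) {B : ℝ} (hf0 : ∀ ω, 0 ≤ f ω) (hfB : ∀ ω, f ω ≤ B) {r : ℝ} (hr : 0 < r) :
    ∫ ω, f ω ∂Q ≤ ∫ ω, f ω ∂P + B * (r + (∫ ω, -Z ω ∂P) / (2 * r)) := by
  have hd : Measurable fun ω => ENNReal.ofReal (Real.exp (Z ω)) := by fun_prop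
  have hchange (φ : Ω → ℝ) : ∫ ω, φ ω ∂Q = ∫ ω, Real.exp (Z ω) * φ ω ∂P := by
    rw [hQ, integral_withDensity_eq_integral_toReal_smul hd (by simp)]
    simp [Real.exp_nonneg]
  have hfb (ω : Ω) : ‖f ω‖ ≤ B := by rw [Real.norm_of_nonneg (hf0 ω)]; exact hfB ω
  have hfP : Integrable f P :=
    Integrable.of_bound hf.aestronglyMeasurable B (Filter.Eventually.of_forall hfb)
  have hfQ : Integrable f Q :=
    Integrable.of_bound hf.aestronglyMeasurable B (Filter.Eventually.of_forall hfb)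
  have hint (φ : Ω → ℝ) (hφ : Integrable φ Q) :
      Integrable (fun ω => Real.exp (Z ω) * φ ω) P := by
    rw [hQ, integrable_withDensity_iff_integrable_smul' hd (by simp)] at hφ
    simpa [Real.exp_nonneg] using hφ
  have hE : Integrable (fun ω => Real.exp (Z ω)) P := by
    simpa using hint (fun _ => 1) (integrable_const _)
  have hE1 : ∫ ω, Real.exp (Z ω) ∂P = 1 := by
    simpa using (hchange fun _ => 1).symm
  -- As `∫ (1 - exp Z) ∂P = 0`, the function `f` may be replaced by `f - B ≤ 0`.
  have hkey : ∫ ω, (B - f ω) * (1 - Real.exp (Z ω)) ∂P ≤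
      ∫ ω, B * (r + (Real.exp (Z ω) - 1 - Z ω) / (2 * r)) ∂P := by
    refine integral_mono ?_ ?_ fun ω => ?_
    · have : Integrable (fun ω => B - B * Real.exp (Z ω) - f ω + Real.exp (Z ω) * f ω) P :=
        (((integrable_const _).sub (hE.const_mul B)).sub hfP).add (hint f hfQ)
      refine this.congr (Filter.Eventually.of_forall fun ω => ?_)
      ring
    · exact ((integrable_const _).add
        (((hE.sub (integrable_const _)).sub hZi).div_const _)).const_mul B
    · have h1 := one_sub_exp_le (Z ω) hr
      have hpos : 0 ≤ r + (Real.exp (Z ω) - 1 - Z ω) / (2 * r) := by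
        have := Real.add_one_le_exp (Z ω)
        have : 0 ≤ (Real.exp (Z ω) - 1 - Z ω) / (2 * r) := div_nonneg (by linarith) (by positivity)
        linarith
      have h2 := mul_le_mul_of_nonneg_left h1 (sub_nonneg.2 (hfB ω))
      have h3 := mul_nonneg (hf0 ω) hpos
      change (B - f ω) * (1 - Real.exp (Z ω)) ≤ B * (r + (Real.exp (Z ω) - 1 - Z ω) / (2 * r))
      linarith
  have hL : ∫ ω, (B - f ω) * (1 - Real.exp (Z ω)) ∂P = ∫ ω, f ω ∂Q - ∫ ω, f ω ∂P := by
    have : (fun ω => (B - f ω) * (1 - Real.exp (Z ω))) =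
        fun ω => B - B * Real.exp (Z ω) - f ω + Real.exp (Z ω) * f ω := by
      ext ω; ring
    have h1 : Integrable (fun ω => B - B * Real.exp (Z ω)) P :=
      (integrable_const _).sub (hE.const_mul B)
    have h2 : Integrable (fun ω => B - B * Real.exp (Z ω) - f ω) P := h1.sub hfP
    rw [this, integral_add h2 (hint f hfQ), integral_sub h1 hfP,
      integral_sub (integrable_const _) (hE.const_mul B), integral_const_mul, hE1, hchange f]
    simp
    ring
  have hR : ∫ ω, B * (r + (Real.exp (Z ω) - 1 - Z ω) / (2 * r)) ∂P =
      B * (r + (∫ ω, -Z ω ∂P) / (2 * r)) := by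
    have h1 : Integrable (fun ω => Real.exp (Z ω) - 1) P := hE.sub (integrable_const _)
    have h2 : Integrable (fun ω => Real.exp (Z ω) - 1 - Z ω) P := h1.sub hZi
    rw [integral_const_mul, integral_add (integrable_const _) (h2.div_const _), integral_div,
      integral_sub h1 hZi, integral_sub hE (integrable_const _), hE1,
      integral_neg]
    simp
  linarith

/-! ### Pull counts and regret -/

section PullCount

/-- The number of pulls of arm `a` recorded in a history. -/
def pullCount {n : ℕ} {𝓜 : Type*} {t : ℕ} (a : Fin n) (h : History n 𝓜 t) : ℝ :=
  ∑ i, if (h i).1 = a then 1 else 0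

theorem pullCount_nonneg {n : ℕ} {𝓜 : Type*} {t : ℕ} (a : Fin n) (h : History n 𝓜 t) :
    0 ≤ pullCount a h :=
  Finset.sum_nonneg fun i _ => by split_ifs <;> simp

theorem pullCount_le {n : ℕ} {𝓜 : Type*} {t : ℕ} (a : Fin n) (h : History n 𝓜 t) :
    pullCount a h ≤ t := by
  calc pullCount a h ≤ ∑ _i : Fin t, (1 : ℝ) :=
        Finset.sum_le_sum fun i _ => by split_ifs <;> simp
    _ = t := by simp

theorem sum_pullCount {n : ℕ} {𝓜 : Type*} {t : ℕ} (h : History n 𝓜 t) :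
    ∑ a, pullCount a h = t := by
  unfold pullCount
  rw [Finset.sum_comm]
  simp

variable {n : ℕ} {𝓜 : Type*} [MeasurableSpace 𝓜]

theorem measurable_pullCount {t : ℕ} (a : Fin n) :
    Measurable (pullCount a : History n 𝓜 t → ℝ) := by
  refine Finset.measurable_fun_sum _ fun i _ => ?_
  exact (measurable_of_countable fun b : Fin n => if b = a then (1 : ℝ) else 0).comp
    (measurable_fst.comp (measurable_pi_apply i))

theorem integrable_pullCount {t : ℕ} (a : Fin n) (P : Measure (History n 𝓜 t))
    [IsFiniteMeasure P] : Integrable (pullCount a) P :=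
  Integrable.of_bound (measurable_pullCount a).aestronglyMeasurable t
    (Filter.Eventually.of_forall fun h => by
      rw [Real.norm_of_nonneg (pullCount_nonneg a h)]; exact pullCount_le a h)

theorem sum_integral_pullCount {t : ℕ} (P : Measure (History n 𝓜 t)) [IsProbabilityMeasure P] :
    ∑ a, ∫ h, pullCount a h ∂P = t := by
  rw [← integral_finsetSum _ fun a _ => integrable_pullCount a P]
  simp [sum_pullCount]

variable [Finite 𝓜] [Nonempty 𝓜] [MeasurableSingletonClass 𝓜]

/-- Raising the mean of arm `a` from `0` to `Δ` increases the expected number of its pulls by an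
amount governed by the divergence `p * Δ ^ 2 / 2` of a single pull times the expected number of
pulls of `a` when all means vanish. -/
theorem integral_pullCount_le (π : Policy n 𝓜) (p : unitInterval) (Δ : ℝ) (a : Fin n) (T : ℕ)
    {r : ℝ} (hr : 0 < r) :
    ∫ h, pullCount a h ∂(historyLaw π (gaussianInstance 𝓜 p (Pi.single a Δ)) T) ≤
      ∫ h, pullCount a h ∂(historyLaw π (gaussianInstance 𝓜 p 0) T) +
        T * (r + (p * Δ ^ 2 / 2 *
          ∫ h, pullCount a h ∂(historyLaw π (gaussianInstance 𝓜 p 0) T)) / (2 * r)) := by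
  set θ : Fin n → ℝ := Pi.single a Δ with hθ
  set P := historyLaw π (gaussianInstance 𝓜 p 0) T
  let g : Fin n × Feedback 𝓜 → ℝ := fun x => logLikelihoodRatio (θ x.1) x.2
  have hg : Measurable g :=
    measurable_from_prod_countable_right fun b => measurable_logLikelihoodRatio (θ b)
  have hQ := historyLaw_eq_withDensity π (ν := gaussianInstance 𝓜 p 0)
    (ν' := gaussianInstance 𝓜 p θ) hg (fun b => map_observe_gaussianLaw p (θ b)) T
  -- The compensated log-likelihood ratio is a sum of centred terms.
  let g' : Fin n × Feedback 𝓜 → ℝ := fun x => g x + p * θ x.1 ^ 2 / 2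
  have hg' : Measurable g' :=
    hg.add ((measurable_of_countable fun b : Fin n => (p : ℝ) * θ b ^ 2 / 2).comp measurable_fst)
  have hfi (b : Fin n) : Integrable (fun F => g (b, F)) ((gaussianInstance 𝓜 p 0).feedback b) :=
    (integrable_logLikelihoodRatio p (θ b)).1
  have hfe (b : Fin n) : ∫ F, g (b, F) ∂((gaussianInstance 𝓜 p 0).feedback b) =
      -(p * θ b ^ 2 / 2) := (integrable_logLikelihoodRatio p (θ b)).2
  obtain ⟨hi, h0⟩ := integral_sum_history_eq_zero π (gaussianInstance 𝓜 p 0) hg'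
    (fun b => (hfi b).add (integrable_const (p * θ b ^ 2 / 2))) (fun b => by
      simp only [g']
      rw [integral_add (hfi b) (integrable_const _), hfe]
      simp) T
  have hsum (h : History n 𝓜 T) :
      ∑ i, g (h i) = ∑ i, g' (h i) - p * Δ ^ 2 / 2 * pullCount a h := by
    rw [pullCount, Finset.mul_sum, ← Finset.sum_sub_distrib]
    refine Finset.sum_congr rfl fun i _ => ?_
    by_cases hb : (h i).1 = a <;> simp [g', hθ, hb]
  have hN : Integrable (fun h => p * Δ ^ 2 / 2 * pullCount a h) P :=
    (integrable_pullCount a P).const_mul _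
  have hZi : Integrable (fun h : History n 𝓜 T => ∑ i, g (h i)) P := by
    simp only [hsum]
    exact hi.sub hN
  have hZ : ∫ h, -∑ i, g (h i) ∂P = p * Δ ^ 2 / 2 * ∫ h, pullCount a h ∂P := by
    simp only [hsum]
    rw [integral_neg, integral_sub hi hN, h0, integral_const_mul]
    ring
  rw [← hZ]
  exact integral_withDensity_exp_le (by fun_prop) hZi hQ (measurable_pullCount a)
    (pullCount_nonneg a) (pullCount_le a) hr

theorem expectedRegret_gaussianInstance_single (π : Policy n 𝓜) (p : unitInterval) {Δ : ℝ}
    (hΔ : 0 ≤ Δ) (a : Fin n) (T : ℕ) :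
    expectedRegret π (gaussianInstance 𝓜 p (Pi.single a Δ)) T =
      Δ * (T - ∫ h, pullCount a h ∂(historyLaw π (gaussianInstance 𝓜 p (Pi.single a Δ)) T)) := by
  have hle (b : Fin n) : (Pi.single a Δ : Fin n → ℝ) b ≤ Δ := by
    by_cases hb : b = a
    · simp [hb]
    · simpa [hb] using hΔ
  have : Nonempty (Fin n) := ⟨a⟩
  have hbest : (gaussianInstance 𝓜 p (Pi.single a Δ)).bestMean = Δ := by
    unfold Instance.bestMean
    simp only [mean_gaussianInstance]
    refine le_antisymm (ciSup_le hle) ?_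
    exact (by simp : Δ ≤ (Pi.single a Δ : Fin n → ℝ) a).trans
      (le_ciSup (Set.finite_range (Pi.single a Δ : Fin n → ℝ)).bddAbove a)
  have hreg (h : History n 𝓜 T) :
      (gaussianInstance 𝓜 p (Pi.single a Δ)).regret h = Δ * (T - pullCount a h) := by
    unfold Instance.regret
    simp only [hbest, mean_gaussianInstance]
    rw [Finset.sum_sub_distrib, mul_sub, pullCount, Finset.mul_sum]
    congr 1
    · simp [mul_comm]
    · refine Finset.sum_congr rfl fun i _ => ?_
      by_cases hb : (h i).1 = a <;> simp [hb]
  unfold expectedRegret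
  simp only [hreg]
  rw [integral_const_mul, integral_sub (integrable_const _) (integrable_pullCount a _)]
  simp

/-- Averaging over the arm whose mean is raised: when all means vanish, the arms receive `T / n` pulls
on average, and a gap with `p * Δ ^ 2 * T = n / 16` is too small for that many pulls
to reveal the raised arm. -/
theorem exists_expectedRegret_ge (π : Policy n 𝓜) (p : unitInterval) {Δ : ℝ} (hΔ : 0 ≤ Δ) {T : ℕ}
    (hn : 2 ≤ n) (hpΔ : p * Δ ^ 2 * T = n / 16) :
    ∃ a : Fin n, Δ * T / 4 ≤ expectedRegret π (gaussianInstance 𝓜 p (Pi.single a Δ)) T := by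
  have hn' : (2 : ℝ) ≤ n := by exact_mod_cast hn
  have : Nonempty (Fin n) := ⟨⟨0, by lia⟩⟩
  have hsum := Finset.sum_le_sum fun (a : Fin n) (_ : a ∈ Finset.univ) =>
    integral_pullCount_le π p Δ a T (r := 8⁻¹) (by norm_num)
  rw [Finset.sum_add_distrib, ← Finset.mul_sum, Finset.sum_add_distrib, ← Finset.sum_div,
    ← Finset.mul_sum, sum_integral_pullCount] at hsum
  simp only [Finset.sum_const, Finset.card_univ, Fintype.card_fin, nsmul_eq_mul] at hsum
  have hT : (0 : ℝ) ≤ T := T.cast_nonneg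
  have hbound : ∑ a : Fin n,
      ∫ h, pullCount a h ∂(historyLaw π (gaussianInstance 𝓜 p (Pi.single a Δ)) T) ≤
        ∑ _a : Fin n, (3 / 4 * T : ℝ) := by
    simp only [Finset.sum_const, Finset.card_univ, Fintype.card_fin, nsmul_eq_mul]
    have : (T : ℝ) * (n * 8⁻¹ + p * Δ ^ 2 / 2 * T / (2 * 8⁻¹)) = T * n / 4 := by
      linear_combination 2 * (T : ℝ) * hpΔ
    nlinarith [mul_nonneg hT (sub_nonneg.2 hn')]
  obtain ⟨a, -, ha⟩ := Finset.exists_le_of_sum_le Finset.univ_nonempty hbound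
  refine ⟨a, ?_⟩
  rw [expectedRegret_gaussianInstance_single π p hΔ]
  nlinarith [mul_le_mul_of_nonneg_left ha hΔ]

end PullCount

end MissingBandit

end

theorem mainTheorem2 :
    ∃ c : ℝ, 0 < c ∧
      ∀ (n T : ℕ) (γ : ℝ), 2 ≤ n → 1 ≤ T → 0 < γ → γ ≤ 1 →
      ∀ (𝓜 : Type*) [Finite 𝓜] [Nonempty 𝓜] [MeasurableSpace 𝓜] [MeasurableSingletonClass 𝓜]
        (π : MissingBandit.Policy n 𝓜),
        ∃ ν : MissingBandit.Instance n 𝓜,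
          ν.IsMCAR γ ∧ ν.IsPositive ∧ ν.IsSubgaussian 1 ∧
          ((n : ℝ) ≤ γ * T → ∀ a m, ν.condMean a m ∈ Set.Icc (0 : ℝ) 1) ∧
          c * Real.sqrt (n * T / γ) ≤ MissingBandit.expectedRegret π ν T := by
  refine ⟨1 / 16, by norm_num, ?_⟩
  intro n T γ hn hT hγ hγ1 𝓜 _ _ _ _ π
  have hT' : (0 : ℝ) < T := by exact_mod_cast hT
  let p : unitInterval := ⟨γ, hγ.le, hγ1⟩
  -- The gap for which `T / n` pulls of an arm carry a divergence of constant order.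
  set Δ : ℝ := Real.sqrt (n / (γ * T)) / 4 with hΔdef
  have hΔ : 0 ≤ Δ := by positivity
  have hsq : Real.sqrt (n / (γ * T)) ^ 2 = n / (γ * T) := Real.sq_sqrt (by positivity)
  have hpΔ : (p : ℝ) * Δ ^ 2 * T = n / 16 := by
    change γ * Δ ^ 2 * T = n / 16
    rw [hΔdef, div_pow, hsq]
    field_simp
    norm_num
  obtain ⟨a, ha⟩ := MissingBandit.exists_expectedRegret_ge π p hΔ hn hpΔ
  refine ⟨MissingBandit.gaussianInstance 𝓜 p (Pi.single a Δ),
    MissingBandit.isMCAR_gaussianInstance p _, MissingBandit.isPositive_gaussianInstance hγ _,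
    MissingBandit.isSubgaussian_gaussianInstance p _, fun hγT b m => ?_, le_trans (le_of_eq ?_) ha⟩
  · rw [MissingBandit.condMean_gaussianInstance]
    have hΔ1 : Δ ≤ 1 := by
      have : Real.sqrt (n / (γ * T)) ≤ 1 := by
        rw [Real.sqrt_le_one, div_le_one (by positivity)]
        exact hγT
      rw [hΔdef]
      linarith
    by_cases hb : b = a
    · simp [hb, hΔ, hΔ1]
    · simp [hb]
  · have : (n : ℝ) * T / γ = n / (γ * T) * (T : ℝ) ^ 2 := by field_simp
    rw [this, Real.sqrt_mul (by positivity), Real.sqrt_sq hT'.le, hΔdef]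
    ring
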